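/- Let $d\ge 0$ and $n\ge 2$ be integers and let $\mathcal B=\{v\in\mathbb R^d:\|v\|_2\le 1\}$ be the closed Euclidean unit ball. Consider the $n$-round online linear optimization game in which, in each round $t=1,\dots,n$, the learner chooses a probability distribution $q_t$ on $\mathcal B$ on the basis of $y_1,\dots,y_{t-1}$ and of its own past decisions $\hat y_1,\dots,\hat y_{t-1}$, Nature provides $y_t\in\mathcal B$, and the learner draws $\hat y_t\sim q_t$ and suffers the loss $\langle \hat y_t,y_t\rangle$. Then the adaptive rate $$ \mathcal B_n(y_{1:n}) = 16\sqrt d\,\log(n)\,\Big\|\Big(\sum_{t=1}^n y_ty_t^{\top}\Big)^{1/2}\Big\|_\sigma+16\sqrt d\,\log(n) $$ is achievable, where $\|\cdot\|_\sigma$ is the spectral norm and $\log$ is the natural logarithm. That is, there exists a randomized algorithm of the learner (a choice of the $q_t$ as above) such that $$ \mathbb E\Big[\sum_{t=1}^n\langle\hat y_t,y_t\rangle-\sum_{t=1}^n\langle f,y_t\rangle\Big]\le \mathcal B_n(y_{1:n})\qquad\text{for all } y_1,\dots,y_n\in\mathcal B\text{ and all } f\in\mathcal B . $$ -/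

import Mathlib

open MeasureTheory ProbabilityTheory

noncomputable section

namespace OnlineLearning

universe u v w

/-- A randomized algorithm for the `n`-round online learning protocol with instances in `X`,
decisions in `D` and outcomes in `Y`. In round `t` (counted from `0`) it chooses a distribution on
`D` knowing the instances `x₀, …, x_t`, the outcomes `y₀, …, y_{t-1}` and its own previous
(random) decisions. -/
structure RandomizedAlgorithm (X : Type u) (D : Type v) (Y : Type w) [MeasurableSpace D]
    (n : ℕ) where
  /-- the distribution `q_t` of the decision of round `t`, given the past -/
  predict : (t : Fin n) → (Fin ((t : ℕ) + 1) → X) → (Fin (t : ℕ) → Y) →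
    Kernel (Fin (t : ℕ) → D) D
  isMarkov : ∀ t x y, IsMarkovKernel (predict t x y)

variable {X : Type u} {D : Type v} {Y : Type w} [MeasurableSpace D] {n : ℕ}

/-- The joint law of the first `t` decisions of the algorithm when Nature plays `x` and `y`. -/
def RandomizedAlgorithm.law (A : RandomizedAlgorithm X D Y n) (x : Fin n → X) (y : Fin n → Y) :
    (t : ℕ) → t ≤ n → Measure (Fin t → D)
  | 0, _ => Measure.dirac Fin.elim0
  | t + 1, h =>
      ((A.law x y t (Nat.le_of_succ_le h)) ⊗ₘ
        (A.predict ⟨t, h⟩ (fun i => x (Fin.castLE h i))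
          (fun i => y (Fin.castLE (Nat.le_of_succ_le h) i)))).map
        (fun p => (Fin.snoc p.1 p.2 : Fin (t + 1) → D))

theorem measurable_snoc_pair (t : ℕ) :
    Measurable (fun p : (Fin t → D) × D => (Fin.snoc p.1 p.2 : Fin (t + 1) → D)) := by
  rw [measurable_pi_iff]
  intro i
  refine Fin.lastCases ?_ (fun j => ?_) i
  · simpa using measurable_snd
  · simp only [Fin.snoc_castSucc]
    exact (measurable_pi_apply j).comp measurable_fst

theorem RandomizedAlgorithm.isProbabilityMeasure_law (A : RandomizedAlgorithm X D Y n)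
    (x : Fin n → X) (y : Fin n → Y) :
    ∀ (t : ℕ) (h : t ≤ n), IsProbabilityMeasure (A.law x y t h)
  | 0, _ => by
      rw [RandomizedAlgorithm.law]
      infer_instance
  | t + 1, h => by
      have h1 := A.isProbabilityMeasure_law x y t (Nat.le_of_succ_le h)
      have h2 := A.isMarkov ⟨t, h⟩ (fun i => x (Fin.castLE h i))
        (fun i => y (Fin.castLE (Nat.le_of_succ_le h) i))
      rw [RandomizedAlgorithm.law]
      exact Measure.isProbabilityMeasure_map (measurable_snoc_pair t).aemeasurable

/-- The adaptive rate `B` is achievable for the loss `loss` and the class `F ⊆ D^X`: some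
randomized algorithm has expected regret (with a genuinely existing expectation) at most
`B f x y` against every `f ∈ F`, for all sequences `x` of instances and `y` of outcomes. -/
def IsAchievable (loss : D → Y → ℝ) (F : Set (X → D)) (n : ℕ)
    (B : (X → D) → (Fin n → X) → (Fin n → Y) → ℝ) : Prop :=
  ∃ A : RandomizedAlgorithm X D Y n, ∀ (x : Fin n → X) (y : Fin n → Y), ∀ f ∈ F,
    Integrable (fun p : Fin n → D => ∑ t, loss (p t) (y t) - ∑ t, loss (f (x t)) (y t))
      (A.law x y n le_rfl) ∧
    ∫ p, (∑ t, loss (p t) (y t) - ∑ t, loss (f (x t)) (y t)) ∂(A.law x y n le_rfl) ≤ B f x y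

/-- The closed Euclidean unit ball of `ℝ^d`. -/
abbrev UnitBall (d : ℕ) : Type :=
  Metric.closedBall (0 : EuclideanSpace ℝ (Fin d)) 1

/-- The linear loss `⟨p, y⟩`. -/
def linearLoss {d : ℕ} (p y : UnitBall d) : ℝ :=
  inner ℝ (p : EuclideanSpace ℝ (Fin d)) (y : EuclideanSpace ℝ (Fin d))

/-- The unit ball as a class of functions from the one-point instance space to decisions. -/
def ballClass (d : ℕ) : Set (Unit → UnitBall d) :=
  Set.range fun (f : UnitBall d) (_ : Unit) => f

/-- The matrix `∑ₜ yₜ yₜᵀ`. -/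
def outerSum {d n : ℕ} (y : Fin n → UnitBall d) : Matrix (Fin d) (Fin d) ℝ :=
  ∑ t, Matrix.vecMulVec (fun i => (y t : EuclideanSpace ℝ (Fin d)) i)
    (fun i => (y t : EuclideanSpace ℝ (Fin d)) i)

/-- The spectral norm of a real matrix: its operator norm for the Euclidean norm. -/
def matrixSpectralNorm {d : ℕ} (M : Matrix (Fin d) (Fin d) ℝ) : ℝ :=
  ‖Matrix.toEuclideanCLM (n := Fin d) (𝕜 := ℝ) M‖

open scoped MatrixOrder in
/-- The positive semidefinite square root of a positive semidefinite real matrix. -/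
def matrixSqrt {d : ℕ} (M : Matrix (Fin d) (Fin d) ℝ) : Matrix (Fin d) (Fin d) ℝ :=
  CFC.sqrt M

/-- The rate `16 √d log n ‖(∑ₜ yₜ yₜᵀ)^{1/2}‖_σ + 16 √d log n`. -/
def spectralRate {d n : ℕ} (y : Fin n → UnitBall d) : ℝ :=
  16 * √(d : ℝ) * Real.log n * matrixSpectralNorm (matrixSqrt (outerSum y))
    + 16 * √(d : ℝ) * Real.log n

end OnlineLearning

end

namespace OnlineLearning

open scoped MatrixOrder

section Deterministic

variable {X : Type*} {D : Type*} {Y : Type*} [MeasurableSpace D] {n : ℕ}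

/-! A deterministic learner suffices: projected gradient descent with step `1 / R`, where `R² = 1 +
∑ ‖yₛ‖²` runs over the outcomes seen so far. Its regret is at most `3R` for the final `R`
(`gradientDescent_potential`). With `S` the square root of `∑ yₜyₜᵀ`, the sum `∑ ‖yₜ‖²` is the trace
of `S * S`, hence at most `d‖S‖²`; so `R ≤ √d (‖S‖ + 1)` once `d ≥ 1`. As `log n ≥ 1/2`, the
constant 16 leaves ample room. -/

/-- The randomized algorithm that plays a deterministic strategy depending only on past
outcomes. -/
noncomputable def RandomizedAlgorithm.ofStrategy (X : Type*) (n : ℕ) (w : (t : ℕ) → (Fin t → Y) → D) :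
    RandomizedAlgorithm X D Y n where
  predict t _ y := Kernel.const _ (Measure.dirac (w t y))
  isMarkov _ _ _ := inferInstance

theorem RandomizedAlgorithm.law_ofStrategy (w : (t : ℕ) → (Fin t → Y) → D)
    (x : Fin n → X) (y : Fin n → Y) (t : ℕ) (h : t ≤ n) :
    (ofStrategy X n w).law x y t h =
      Measure.dirac fun i : Fin t => w i fun j => y (Fin.castLE (i.2.le.trans h) j) := by
  induction t with
  | zero =>
    rw [RandomizedAlgorithm.law]
    congr 1
    exact Subsingleton.elim _ _
  | succ t ih =>
    rw [RandomizedAlgorithm.law, ih]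
    simp only [ofStrategy, Measure.compProd_const]
    rw [Measure.dirac_prod_dirac, Measure.map_dirac' (measurable_snoc_pair t)]
    congr 1
    funext i
    refine Fin.lastCases ?_ (fun j => ?_) i
    · simp only [Fin.snoc_last]
      rfl
    · simp only [Fin.snoc_castSucc]
      rfl

/-- A regret bound for a deterministic strategy yields achievability. -/
theorem isAchievable_of_strategy [MeasurableSingletonClass D] {loss : D → Y → ℝ}
    {F : Set (X → D)} {B : (X → D) → (Fin n → X) → (Fin n → Y) → ℝ}
    (w : (t : ℕ) → (Fin t → Y) → D)
    (hw : ∀ (x : Fin n → X) (y : Fin n → Y), ∀ f ∈ F,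
      ∑ t : Fin n, loss (w t fun j => y (Fin.castLE t.2.le j)) (y t) - ∑ t, loss (f (x t)) (y t)
        ≤ B f x y) :
    IsAchievable loss F n B := by
  refine ⟨RandomizedAlgorithm.ofStrategy X n w, fun x y f hf => ?_⟩
  rw [RandomizedAlgorithm.law_ofStrategy]
  refine ⟨integrable_dirac (by simp), ?_⟩
  rw [integral_dirac]
  exact hw x y f hf

end Deterministic

section GradientDescent

variable {d : ℕ}

/-- Projection onto the closed unit ball does not increase the distance to points of the ball. -/
theorem exists_unitBall_dist_le (x : EuclideanSpace ℝ (Fin d)) :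
    ∃ p : UnitBall d, ∀ f : UnitBall d,
      ‖(p : EuclideanSpace ℝ (Fin d)) - f‖ ^ 2 ≤ ‖x - f‖ ^ 2 := by
  have hc : Convex ℝ (Metric.closedBall (0 : EuclideanSpace ℝ (Fin d)) 1) :=
    convex_closedBall 0 1
  obtain ⟨p, hp, hmin⟩ := exists_norm_eq_iInf_of_complete_convex
    (K := Metric.closedBall (0 : EuclideanSpace ℝ (Fin d)) 1) ⟨0, by simp⟩
    Metric.isClosed_closedBall.isComplete hc x
  rw [norm_eq_iInf_iff_real_inner_le_zero hc hp] at hmin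
  refine ⟨⟨p, hp⟩, fun f => ?_⟩
  have h := hmin f f.2
  have e : x - (f : EuclideanSpace ℝ (Fin d)) = (x - p) - (f - p) := by abel
  rw [e, norm_sub_sq_real (x - p), norm_sub_rev]
  nlinarith [sq_nonneg ‖x - p‖]

/-- The metric projection onto the closed unit ball. -/
noncomputable def unitBallProj (x : EuclideanSpace ℝ (Fin d)) : UnitBall d :=
  (exists_unitBall_dist_le x).choose

theorem norm_unitBallProj_sub_sq_le (x : EuclideanSpace ℝ (Fin d)) (f : UnitBall d) :
    ‖(unitBallProj x : EuclideanSpace ℝ (Fin d)) - f‖ ^ 2 ≤ ‖x - f‖ ^ 2 :=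
  (exists_unitBall_dist_le x).choose_spec f

/-- The inverse step size `√(1 + ∑ ‖yₛ‖²)`. -/
noncomputable def invStep {t : ℕ} (y : Fin t → UnitBall d) : ℝ :=
  √(1 + ∑ s, ‖(y s : EuclideanSpace ℝ (Fin d))‖ ^ 2)

/-- Projected online gradient descent with the adaptive step size `1 / invStep`. -/
noncomputable def gradientDescent : (t : ℕ) → (Fin t → UnitBall d) → UnitBall d
  | 0, _ => ⟨0, by simp⟩
  | t + 1, y => unitBallProj
      ((gradientDescent t (Fin.init y) : EuclideanSpace ℝ (Fin d))
        - (invStep y)⁻¹ • (y (Fin.last t) : EuclideanSpace ℝ (Fin d)))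

theorem invStep_sq {t : ℕ} (y : Fin t → UnitBall d) :
    invStep y ^ 2 = 1 + ∑ s, ‖(y s : EuclideanSpace ℝ (Fin d))‖ ^ 2 :=
  Real.sq_sqrt (by positivity)

theorem invStep_pos {t : ℕ} (y : Fin t → UnitBall d) : 0 < invStep y :=
  Real.sqrt_pos.2 (by positivity)

theorem invStep_succ_sq {t : ℕ} (y : Fin (t + 1) → UnitBall d) :
    invStep y ^ 2 = invStep (Fin.init y) ^ 2
      + ‖(y (Fin.last t) : EuclideanSpace ℝ (Fin d))‖ ^ 2 := by
  rw [invStep_sq, invStep_sq, Fin.sum_univ_castSucc, add_assoc]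
  rfl

theorem norm_unitBall_sub_sq_le (p f : UnitBall d) :
    ‖(p : EuclideanSpace ℝ (Fin d)) - f‖ ^ 2 ≤ 4 := by
  have hp := mem_closedBall_zero_iff.1 p.2
  have hf := mem_closedBall_zero_iff.1 f.2
  have h := norm_sub_le (p : EuclideanSpace ℝ (Fin d)) f
  nlinarith [norm_nonneg ((p : EuclideanSpace ℝ (Fin d)) - f)]

/-- One step of projected gradient descent with step size `1 / r`. -/
theorem inner_le_of_unitBallProj_step (w f y : UnitBall d) {r : ℝ} (hr : 0 < r) :
    linearLoss w y - linearLoss f y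
      + ‖(unitBallProj ((w : EuclideanSpace ℝ (Fin d)) - r⁻¹ • (y : EuclideanSpace ℝ (Fin d))) :
          EuclideanSpace ℝ (Fin d)) - f‖ ^ 2 * r / 2
      ≤ ‖(w : EuclideanSpace ℝ (Fin d)) - f‖ ^ 2 * r / 2
        + ‖(y : EuclideanSpace ℝ (Fin d))‖ ^ 2 / (2 * r) := by
  have h := norm_unitBallProj_sub_sq_le
    ((w : EuclideanSpace ℝ (Fin d)) - r⁻¹ • (y : EuclideanSpace ℝ (Fin d))) f
  rw [sub_right_comm, norm_sub_sq_real (_ - _) (r⁻¹ • _), inner_smul_right, norm_smul, mul_pow,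
    Real.norm_eq_abs, sq_abs, inner_sub_left] at h
  have h2 := mul_le_mul_of_nonneg_right h (half_pos hr).le
  unfold linearLoss
  generalize inner ℝ (w : EuclideanSpace ℝ (Fin d)) (y : EuclideanSpace ℝ (Fin d)) = a at *
  generalize inner ℝ (f : EuclideanSpace ℝ (Fin d)) (y : EuclideanSpace ℝ (Fin d)) = b at *
  generalize ‖(w : EuclideanSpace ℝ (Fin d)) - f‖ ^ 2 = u at *
  generalize ‖(y : EuclideanSpace ℝ (Fin d))‖ ^ 2 = v at *
  have e : (u - 2 * (r⁻¹ * (a - b)) + r⁻¹ ^ 2 * v) * (r / 2)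
      = u * r / 2 - (a - b) + v / (2 * r) := by
    field_simp
  rw [e] at h2
  linarith

/-- When `R'` grows to `R`, reweighting the squared distance (at most 4) costs `2(R - R')` and the
gradient term at most `R - R'`; the total `3(R - R')` telescopes. -/
theorem gradientDescent_potential (f : UnitBall d) (t : ℕ) (y : Fin t → UnitBall d) :
    ∑ s : Fin t, (linearLoss (gradientDescent s fun j => y (Fin.castLE s.2.le j)) (y s)
        - linearLoss f (y s))
      + ‖(gradientDescent t y : EuclideanSpace ℝ (Fin d)) - f‖ ^ 2 * invStep y / 2
      ≤ 3 * invStep y := by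
  induction t with
  | zero =>
    have h1 := norm_unitBall_sub_sq_le (gradientDescent 0 y) f
    have h2 := invStep_pos y
    rw [Fin.sum_univ_zero]
    nlinarith
  | succ t ih =>
    have ih := ih (Fin.init y)
    have hstep := inner_le_of_unitBallProj_step (gradientDescent t (Fin.init y)) f
      (y (Fin.last t)) (invStep_pos y)
    have hD := norm_unitBall_sub_sq_le (gradientDescent t (Fin.init y)) f
    have hsq := invStep_succ_sq y
    have hr := invStep_pos y
    have hr' := invStep_pos (Fin.init y)
    have hle : invStep (Fin.init y) ≤ invStep y := by
      nlinarith [sq_nonneg ‖(y (Fin.last t) : EuclideanSpace ℝ (Fin d))‖]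
    -- Here `‖y‖² = (R - R')(R + R') ≤ 2R(R - R')`; this needs `R` to include the current outcome.
    have hquad : ‖(y (Fin.last t) : EuclideanSpace ℝ (Fin d))‖ ^ 2 / (2 * invStep y)
        ≤ invStep y - invStep (Fin.init y) := by
      rw [div_le_iff₀ (by positivity)]
      nlinarith
    rw [Fin.sum_univ_castSucc]
    change _ + (linearLoss (gradientDescent t (Fin.init y)) (y (Fin.last t)) - _) +
      ‖(unitBallProj ((gradientDescent t (Fin.init y) : EuclideanSpace ℝ (Fin d))
        - (invStep y)⁻¹ • (y (Fin.last t) : EuclideanSpace ℝ (Fin d))) :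
          EuclideanSpace ℝ (Fin d)) - f‖ ^ 2 * invStep y / 2 ≤ _
    have hprod := mul_le_mul_of_nonneg_right hD (sub_nonneg.2 hle)
    have ih' : ∑ s : Fin t, (linearLoss (gradientDescent (s.castSucc : Fin (t + 1))
        fun j => y (Fin.castLE s.castSucc.2.le j)) (y s.castSucc) - linearLoss f (y s.castSucc))
        + ‖(gradientDescent t (Fin.init y) : EuclideanSpace ℝ (Fin d)) - f‖ ^ 2
          * invStep (Fin.init y) / 2 ≤ 3 * invStep (Fin.init y) := ih
    linarith

/-- The regret of adaptive gradient descent on the unit ball. -/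
theorem gradientDescent_regret_le (f : UnitBall d) {n : ℕ} (y : Fin n → UnitBall d) :
    ∑ s : Fin n, linearLoss (gradientDescent s fun j => y (Fin.castLE s.2.le j)) (y s)
        - ∑ s, linearLoss f (y s) ≤ 3 * invStep y := by
  have h := gradientDescent_potential f n y
  have h2 : 0 ≤ ‖(gradientDescent n y : EuclideanSpace ℝ (Fin d)) - f‖ ^ 2 * invStep y / 2 := by
    have := invStep_pos y
    positivity
  rw [Finset.sum_sub_distrib] at h
  linarith

end GradientDescent

section Spectral

variable {d : ℕ}

theorem trace_mul_self_le_spectralNorm {M : Matrix (Fin d) (Fin d) ℝ} (hM : M.IsHermitian) :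
    (M * M).trace ≤ d * matrixSpectralNorm M ^ 2 := by
  -- By symmetry the diagonal entry is `‖M eᵢ‖²`.
  have key : ∀ i, (M * M) i i ≤ matrixSpectralNorm M ^ 2 := fun i => by
    have h := (Matrix.toEuclideanCLM (n := Fin d) (𝕜 := ℝ) M).le_opNorm
      (EuclideanSpace.single i 1)
    rw [PiLp.norm_single, norm_one, mul_one] at h
    have h2 := pow_le_pow_left₀ (norm_nonneg _) h 2
    refine le_trans (le_of_eq ?_) h2
    rw [EuclideanSpace.real_norm_sq_eq, Matrix.mul_apply]
    refine Finset.sum_congr rfl fun j _ => ?_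
    have e : M i j = M j i := by simpa using hM.apply j i
    rw [e, ← sq]
    simp [Matrix.ofLp_toEuclideanCLM]
  calc (M * M).trace ≤ ∑ _i : Fin d, matrixSpectralNorm M ^ 2 :=
        Finset.sum_le_sum fun i _ => key i
    _ = d * matrixSpectralNorm M ^ 2 := by simp

theorem posSemidef_outerSum {n : ℕ} (y : Fin n → UnitBall d) : (outerSum y).PosSemidef := by
  refine Matrix.posSemidef_sum _ fun t _ => ?_
  simpa using Matrix.posSemidef_vecMulVec_self_star
    (fun i => (y t : EuclideanSpace ℝ (Fin d)) i)

theorem trace_outerSum {n : ℕ} (y : Fin n → UnitBall d) :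
    (outerSum y).trace = ∑ t, ‖(y t : EuclideanSpace ℝ (Fin d))‖ ^ 2 := by
  rw [outerSum, Matrix.trace_sum]
  refine Finset.sum_congr rfl fun t _ => ?_
  rw [Matrix.trace_vecMulVec, EuclideanSpace.real_norm_sq_eq]
  simp [dotProduct, sq]

theorem sum_norm_sq_le_spectralNorm {n : ℕ} (y : Fin n → UnitBall d) :
    ∑ t, ‖(y t : EuclideanSpace ℝ (Fin d))‖ ^ 2
      ≤ d * matrixSpectralNorm (matrixSqrt (outerSum y)) ^ 2 := by
  have hA : 0 ≤ outerSum y := (posSemidef_outerSum y).nonneg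
  have hS : (matrixSqrt (outerSum y)).IsHermitian :=
    (Matrix.nonneg_iff_posSemidef.1 (CFC.sqrt_nonneg (outerSum y))).isHermitian
  have h := trace_mul_self_le_spectralNorm hS
  rwa [matrixSqrt, CFC.sqrt_mul_sqrt_self _ hA, trace_outerSum] at h

theorem three_mul_invStep_le_spectralRate {n : ℕ} (hd : 1 ≤ d) (hn : 2 ≤ n)
    (y : Fin n → UnitBall d) : 3 * invStep y ≤ spectralRate y := by
  have hσ : 0 ≤ matrixSpectralNorm (matrixSqrt (outerSum y)) := norm_nonneg _
  have hsum := sum_norm_sq_le_spectralNorm y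
  have hd' : 1 ≤ √(d : ℝ) := Real.one_le_sqrt.2 (by exact_mod_cast hd)
  have hlog : 1 / 2 ≤ Real.log n :=
    (by linarith [Real.log_two_gt_d9] : 1 / 2 ≤ Real.log 2).trans
      (Real.log_le_log two_pos (by exact_mod_cast hn))
  have hstep : invStep y ≤ √(d : ℝ) * matrixSpectralNorm (matrixSqrt (outerSum y)) + √d := by
    refine Real.sqrt_le_iff.2 ⟨by positivity, ?_⟩
    have hdd : √(d : ℝ) ^ 2 = d := Real.sq_sqrt (Nat.cast_nonneg d)
    have hd1 : (1 : ℝ) ≤ d := by exact_mod_cast hd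
    -- The square of the right side is `dσ² + 2dσ + d`, and its last term absorbs the 1 in
    -- `invStep`.
    nlinarith [mul_nonneg (Nat.cast_nonneg (α := ℝ) d) hσ]
  unfold spectralRate
  generalize matrixSpectralNorm (matrixSqrt (outerSum y)) = σ at *
  have h1 : 0 ≤ √(d : ℝ) * σ + √d := by positivity
  nlinarith [mul_le_mul_of_nonneg_left hlog h1]

end Spectral

end OnlineLearning

theorem mainTheorem7 (d n : ℕ) (hn : 2 ≤ n) :
    OnlineLearning.IsAchievable (X := Unit) (OnlineLearning.linearLoss (d := d))
      (OnlineLearning.ballClass d) n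
      (fun _ _ y => OnlineLearning.spectralRate y) := by
  refine OnlineLearning.isAchievable_of_strategy OnlineLearning.gradientDescent ?_
  rintro x y _ ⟨f, rfl⟩
  -- For `d = 0` the rate is 0 while `invStep` is 1, so the general bound fails; but all losses
  -- vanish.
  rcases Nat.eq_zero_or_pos d with rfl | hd
  · simp [OnlineLearning.linearLoss, OnlineLearning.spectralRate, PiLp.inner_apply]
  · exact (OnlineLearning.gradientDescent_regret_le f y).trans
      (OnlineLearning.three_mul_invStep_le_spectralRate hd hn y)
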